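/- **Setting.** Let $C\subset\mathbb R$ be compact, let $\mathcal P$ be the set of Borel probability measures on $C$, and let $\rho:\mathcal P\to\mathbb R$ be any risk functional (a map). Let $K\in\mathbb N$, let $\mathcal Q_1,\dots,\mathcal Q_K\subseteq\mathcal P$ and let $\mathcal Q=\mathcal Q_1\times\dots\times\mathcal Q_K$ be the corresponding product class of bandit models $\nu=(\nu_1,\dots,\nu_K)$. A policy $\pi$ chooses, in every round $t$, an arm $A_t\in\{1,\dots,K\}$, possibly at random, with a conditional law depending (measurably) only on the past actions and rewards; a reward with law $\nu_{A_t}$ is then observed. Let $T_k(n)=\sum_{t=1}^n\mathbb 1\{A_t=k\}$, let $\mathbb E_\nu$ denote expectation under the interaction of $\pi$ with $\nu$, and let $$\mathcal R^\rho_\nu(\pi,n)=\mathbb E_\nu\Big[\sum_{t=1}^n\big(\max_{j}\rho(\nu_j)-\rho(\nu_{A_t})\big)\Big].$$ The policy $\pi$ is consistent on $\mathcal Q$ if $\lim_{n\to\infty}\mathcal R^\rho_\nu(\pi,n)/n^a=0$ for every $\nu\in\mathcal Q$ and every $a>0$. For $\mu\in\mathcal P$ and $r\in\mathbb R$ put $$\mathcal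 K_{\inf}^{\rho,\mathcal Q_k}(\mu,r)=\inf\{\mathrm{KL}(\mu,\eta):\eta\in\mathcal Q_k,\ \rho(\eta)>r\},\qquad \overline{\mathcal K}_{\inf}^{\rho,\mathcal Q_k}(\mu,r)=\inf\{\mathrm{KL}(\mu,\eta):\eta\in\mathcal Q_k,\ \rho(\eta)\ge r\},$$ with values in $[0,\infty]$ and $\inf\emptyset=\infty$. **Theorem.** Let $\pi$ be a consistent policy on $\mathcal Q$, let $\nu\in\mathcal Q$, let $k^*$ be an optimal arm (without loss of generality $k^*=1$), i.e. $r^\rho_{k^*}:=\rho(\nu_{k^*})=\max_j\rho(\nu_j)$, and let $k$ be a suboptimal arm, i.e. $\rho(\nu_k)<r^\rho_{k^*}$. Then $$\liminf_{n\to\infty}\frac{\mathbb E_\nu[T_k(n)]}{\log n}\ \ge\ \frac1{\mathcal K_{\inf}^{\rho,\mathcal Q_k}(\nu_k,r^\rho_{k^*})}$$ (with $1/\infty=0$ and $1/0=\infty$). Moreover, if $r\mapsto\overline{\mathcal K}_{\inf}^{\rho,\mathcal Q_k}(\nu_k,r)$ is continuous from the right at $r^\rho_{k^*}$ as a $[0,\infty]$-valued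 function, then the same bound holds with $\overline{\mathcal K}_{\inf}^{\rho,\mathcal Q_k}$ in place of $\mathcal K_{\inf}^{\rho,\mathcal Q_k}$. -/

import Mathlib

open MeasureTheory ProbabilityTheory InformationTheory Filter Topology
open scoped ENNReal

noncomputable section

namespace RiskBandit

/-- A (possibly randomized) policy for a bandit with `K` arms and rewards in `R`: the law of the
first action, and for each `n` the conditional law of the next action given the actions and rewards
`(A_i, X_i)` of the rounds `0, …, n`. -/
structure Policy (K : ℕ) (R : Type*) [MeasurableSpace R] where
  first : ProbabilityMeasure (Fin K)
  next : (n : ℕ) → Kernel ((i : Finset.Iic n) → Fin K × R) (Fin K)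
  next_markov : ∀ n, IsMarkovKernel (next n)

variable {K : ℕ} {R : Type*} [MeasurableSpace R]

/-- The reward kernel of a bandit model `ν`: the reward of arm `k` has law `ν k`. -/
def rewardKernel (ν : Fin K → ProbabilityMeasure R) : Kernel (Fin K) R :=
  Kernel.ofFunOfCountable fun k => (ν k : Measure R)

instance (ν : Fin K → ProbabilityMeasure R) : IsMarkovKernel (rewardKernel ν) :=
  ⟨fun k => inferInstanceAs (IsProbabilityMeasure (ν k : Measure R))⟩

/-- One round after the first: given the history, the action is drawn from the policy and the reward
from the law of the chosen arm, independently of the history given the action. -/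
def roundKernel (π : Policy K R) (ν : Fin K → ProbabilityMeasure R) (n : ℕ) :
    Kernel ((i : Finset.Iic n) → Fin K × R) (Fin K × R) :=
  π.next n ⊗ₖ (rewardKernel ν).prodMkLeft ((i : Finset.Iic n) → Fin K × R)

instance (π : Policy K R) (ν : Fin K → ProbabilityMeasure R) (n : ℕ) :
    IsMarkovKernel (roundKernel π ν n) := by
  have := π.next_markov n
  unfold roundKernel
  infer_instance

/-- The law, on infinite sequences of (action, reward) pairs, of the interaction of the policy `π`
with the bandit model `ν`. Rounds are numbered from `0`. -/
def law (π : Policy K R) (ν : Fin K → ProbabilityMeasure R) : Measure (ℕ → Fin K × R) :=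
  Kernel.trajMeasure (X := fun _ => Fin K × R)
    ((π.first : Measure (Fin K)) ⊗ₘ rewardKernel ν) (roundKernel π ν)

/-- `T_k(n)`: the number of pulls of arm `k` in the first `n` rounds. -/
def pulls (k : Fin K) (n : ℕ) (ω : ℕ → Fin K × R) : ℕ :=
  ((Finset.range n).filter fun t => (ω t).1 = k).card

/-- `E_ν[T_k(n)]` under the policy `π`. -/
def expectedPulls (π : Policy K R) (ν : Fin K → ProbabilityMeasure R) (k : Fin K) (n : ℕ) : ℝ :=
  ∫ ω, (pulls k n ω : ℝ) ∂(law π ν)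

/-- The `ρ`-risk regret `E_ν[∑_{t ≤ n} (max_k ρ(ν_k) - ρ(ν_{A_t}))]`. -/
def regret (ρ : ProbabilityMeasure R → ℝ) (π : Policy K R) (ν : Fin K → ProbabilityMeasure R)
    (n : ℕ) : ℝ :=
  ∫ ω, ∑ t ∈ Finset.range n, ((⨆ k, ρ (ν k)) - ρ (ν (ω t).1)) ∂(law π ν)

/-- `π` is consistent on the product class `𝒬 0 × ⋯ × 𝒬 (K - 1)`: on every model of the class the
regret is `o(n^a)` for every `a > 0`. -/
def Consistent (ρ : ProbabilityMeasure R → ℝ) (𝒬 : Fin K → Set (ProbabilityMeasure R))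
    (π : Policy K R) : Prop :=
  ∀ ν : Fin K → ProbabilityMeasure R, (∀ k, ν k ∈ 𝒬 k) → ∀ a : ℝ, 0 < a →
    Tendsto (fun n : ℕ => regret ρ π ν n / (n : ℝ) ^ a) atTop (𝓝 0)

/-- `inf {KL(μ, η) : η ∈ 𝒬, ρ(η) > r}`, equal to `∞` if there is no such `η`. -/
def Kinf (ρ : ProbabilityMeasure R → ℝ) (𝒬 : Set (ProbabilityMeasure R))
    (μ : ProbabilityMeasure R) (r : ℝ) : ℝ≥0∞ :=
  ⨅ η ∈ {η ∈ 𝒬 | r < ρ η}, klDiv (μ : Measure R) (η : Measure R)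

/-- `inf {KL(μ, η) : η ∈ 𝒬, ρ(η) ≥ r}`, equal to `∞` if there is no such `η`. -/
def KinfGe (ρ : ProbabilityMeasure R → ℝ) (𝒬 : Set (ProbabilityMeasure R))
    (μ : ProbabilityMeasure R) (r : ℝ) : ℝ≥0∞ :=
  ⨅ η ∈ {η ∈ 𝒬 | r ≤ ρ η}, klDiv (μ : Measure R) (η : Measure R)

end RiskBandit

end

/-! Change of measure, in the manner of Lai and Robbins. Let `η` be an admissible law for arm `k`
with `ρ η` above the optimal value, and let `ν'` be `ν` with arm `k` replaced by `η`. Under `ν`,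
consistency makes pulls of `k` rare; under `ν'`, arm `k` is the unique best arm, so rounds without
`k` are rare. Both counts are at most `n ^ a / 4` in expectation, eventually, for each `a > 0`.

The models differ only in arm `k`, so the log-likelihood ratio `S` of the histories has mean
`E_ν[T_k(n)] * KL`. A Bretagnolle-Huber type bound (`exp_neg_le_law_add_law_compl`) with the event
`T_k(n) ≥ n / 2` and Markov's inequality give `n * exp (-(E_ν[T_k(n)] * KL + 1)) ≤ n ^ a`. Taking
logarithms and letting `a → 0` gives the bound `1 / KL` for this `η`; the supremum over `η` gives `1
/ Kinf`. -/

namespace RiskBandit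

/-! ### Laws of histories and their domination under a change of model -/

section Law

variable {K : ℕ} {R : Type*} [MeasurableSpace R]

instance (π : Policy K R) (ν : Fin K → ProbabilityMeasure R) : IsProbabilityMeasure (law π ν) := by
  unfold law
  infer_instance

@[simp]
lemma rewardKernel_apply (ν : Fin K → ProbabilityMeasure R) (a : Fin K) :
    rewardKernel ν a = (ν a : Measure R) := rfl

/-- The law of the first action-reward pair. -/
lemma law_map_zero (π : Policy K R) (ν : Fin K → ProbabilityMeasure R) :
    (law π ν).map (fun ω => ω 0) = (π.first : Measure (Fin K)) ⊗ₘ rewardKernel ν := by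
  set m := (π.first : Measure (Fin K)) ⊗ₘ rewardKernel ν
  have h1 : (law π ν).map (Preorder.frestrictLe (π := fun _ : ℕ => Fin K × R) 0) =
      m.map (MeasurableEquiv.piUnique (fun _ : Finset.Iic (0 : ℕ) => Fin K × R)).symm := by
    unfold law Kernel.trajMeasure
    rw [Measure.map_comp _ _ (by fun_prop), Kernel.traj_map_frestrictLe, Kernel.partialTraj_self,
      Measure.id_comp]
  have h2 : (fun ω : ℕ → Fin K × R => ω 0) =
      (fun h : Finset.Iic (0 : ℕ) → Fin K × R => h ⟨0, by simp⟩) ∘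
        (Preorder.frestrictLe (π := fun _ : ℕ => Fin K × R) 0) := rfl
  rw [h2, ← Measure.map_map (by fun_prop) (by fun_prop), h1,
    Measure.map_map (by fun_prop) (by fun_prop)]
  exact Measure.map_id

/-- The joint law of the history up to time `n` and the pair of round `n + 1`. -/
lemma law_map_prod_succ (π : Policy K R) (ν : Fin K → ProbabilityMeasure R) (n : ℕ) :
    (law π ν).map (fun ω => (Preorder.frestrictLe (π := fun _ : ℕ => Fin K × R) n ω, ω (n + 1))) =
      (law π ν).map (Preorder.frestrictLe (π := fun _ : ℕ => Fin K × R) n) ⊗ₘ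
        roundKernel π ν n :=
  (Kernel.map_frestrictLe_trajMeasure_compProd_eq_map_trajMeasure
    (X := fun _ => Fin K × R)).symm

lemma lintegral_roundKernel (π : Policy K R) (ν : Fin K → ProbabilityMeasure R) (n : ℕ)
    (h : (i : Finset.Iic n) → Fin K × R) {f : Fin K × R → ℝ≥0∞} (hf : Measurable f) :
    ∫⁻ y, f y ∂(roundKernel π ν n h) = ∫⁻ a, ∫⁻ x, f (a, x) ∂(ν a : Measure R) ∂(π.next n h) := by
  have := π.next_markov n
  rw [roundKernel, Kernel.lintegral_compProd _ _ _ hf]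
  rfl

/-- Every round's reward has law `ν a` given the action `a`. -/
lemma law_map_eval (π : Policy K R) (ν : Fin K → ProbabilityMeasure R) (t : ℕ) :
    (law π ν).map (fun ω => ω t) = (law π ν).map (fun ω => (ω t).1) ⊗ₘ rewardKernel ν := by
  -- Any such `m` is forced to be the law of the action, as the first marginal.
  suffices h : ∃ m : Measure (Fin K), IsProbabilityMeasure m ∧
      (law π ν).map (fun ω => ω t) = m ⊗ₘ rewardKernel ν by
    obtain ⟨m, hm, h⟩ := h
    have h' : (law π ν).map (fun ω => (ω t).1) = m := by
      have : (fun ω : ℕ → Fin K × R => (ω t).1) = Prod.fst ∘ (fun ω => ω t) := rfl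
      rw [this, ← Measure.map_map (by fun_prop) (by fun_prop), h]
      exact Measure.fst_compProd m _
    rw [h', h]
  cases t with
  | zero => exact ⟨_, inferInstance, law_map_zero π ν⟩
  | succ n =>
    have := π.next_markov n
    set H := (law π ν).map (Preorder.frestrictLe (π := fun _ : ℕ => Fin K × R) n)
    have : IsProbabilityMeasure H := Measure.isProbabilityMeasure_map (by fun_prop)
    refine ⟨π.next n ∘ₘ H, inferInstance, ?_⟩
    have e : (fun ω : ℕ → Fin K × R => ω (n + 1)) = Prod.snd ∘
        (fun ω => (Preorder.frestrictLe (π := fun _ : ℕ => Fin K × R) n ω, ω (n + 1))) := rfl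
    rw [e, ← Measure.map_map (by fun_prop) (by fun_prop), law_map_prod_succ]
    refine Measure.ext_of_lintegral _ fun f hf => ?_
    rw [lintegral_map hf (by fun_prop), Measure.lintegral_compProd (by fun_prop),
      Measure.lintegral_compProd hf, Measure.lintegral_bind (by fun_prop)]
    · simp_rw [lintegral_roundKernel π ν n _ hf]
      rfl
    · exact (measurable_of_finite _).aemeasurable

/-- Domination of the one-step reward laws extends to domination of the laws of histories. -/
lemma lintegral_law_mul_prod_le (π : Policy K R) (ν ν' : Fin K → ProbabilityMeasure R)
    {w : Fin K × R → ℝ≥0∞} (hw : Measurable w)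
    (hle : ∀ a, ∀ f : R → ℝ≥0∞, Measurable f →
      ∫⁻ x, f x * w (a, x) ∂(ν a : Measure R) ≤ ∫⁻ x, f x ∂(ν' a : Measure R))
    (n : ℕ) {g : ((i : Finset.Iic n) → Fin K × R) → ℝ≥0∞} (hg : Measurable g) :
    ∫⁻ ω, g (Preorder.frestrictLe (π := fun _ : ℕ => Fin K × R) n ω) *
        ∏ t ∈ Finset.range (n + 1), w (ω t) ∂(law π ν) ≤
      ∫⁻ ω, g (Preorder.frestrictLe (π := fun _ : ℕ => Fin K × R) n ω) ∂(law π ν') := by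
  induction n with
  | zero =>
    have key : ∀ (ν : Fin K → ProbabilityMeasure R) {f : Fin K × R → ℝ≥0∞}, Measurable f →
        ∫⁻ ω, f (ω 0) ∂(law π ν) = ∫⁻ a, ∫⁻ x, f (a, x) ∂(ν a : Measure R) ∂π.first := by
      intro ν f hf
      rw [← lintegral_map (g := fun ω : ℕ → Fin K × R => ω 0) hf (by fun_prop), law_map_zero,
        Measure.lintegral_compProd hf]
      rfl
    have hG : Measurable fun y : Fin K × R => g (fun _ => y) := by fun_prop
    have e : ∀ ω : ℕ → Fin K × R, g (Preorder.frestrictLe (π := fun _ : ℕ => Fin K × R) 0 ω) =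
        (fun y : Fin K × R => g (fun _ => y)) (ω 0) := by
      intro ω
      congr 1
      ext1 ⟨i, hi⟩
      obtain rfl : i = 0 := by simpa using hi
      rfl
    simp only [e, zero_add, Finset.range_one, Finset.prod_singleton]
    rw [key ν' hG, key ν (f := fun y => g (fun _ => y) * w y) (by fun_prop)]
    exact lintegral_mono fun a => hle a (fun x => g fun _ => (a, x)) (by fun_prop)
  | succ n ih =>
    let ext : ((i : Finset.Iic n) → Fin K × R) × (Fin K × R) →
        ((i : Finset.Iic (n + 1)) → Fin K × R) :=
      fun p i => if h : i.1 ≤ n then p.1 ⟨i.1, by simpa using h⟩ else p.2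
    have hext : Measurable ext := by
      refine measurable_pi_lambda _ fun i => ?_
      by_cases h : i.1 ≤ n
      · simp only [ext, h, dite_true]
        fun_prop
      · simp only [ext, h, dite_false]
        fun_prop
    have eext : ∀ ω : ℕ → Fin K × R,
        Preorder.frestrictLe (π := fun _ : ℕ => Fin K × R) (n + 1) ω =
          ext (Preorder.frestrictLe (π := fun _ : ℕ => Fin K × R) n ω, ω (n + 1)) := by
      intro ω
      ext1 ⟨i, hi⟩
      have hi' : i ≤ n + 1 := by simpa using hi
      by_cases h : i ≤ n
      · simp [ext, h]
      · obtain rfl : i = n + 1 := by omega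
        simp [ext]
    have key : ∀ (ν : Fin K → ProbabilityMeasure R)
        {f : ((i : Finset.Iic n) → Fin K × R) × (Fin K × R) → ℝ≥0∞}, Measurable f →
        ∫⁻ ω, f (Preorder.frestrictLe (π := fun _ : ℕ => Fin K × R) n ω, ω (n + 1)) ∂(law π ν) =
          ∫⁻ ω, ∫⁻ y, f (Preorder.frestrictLe (π := fun _ : ℕ => Fin K × R) n ω, y)
            ∂(roundKernel π ν n (Preorder.frestrictLe (π := fun _ : ℕ => Fin K × R) n ω))
              ∂(law π ν) := by
      intro ν f hf
      have h1 := lintegral_map (μ := law π ν) (g := fun ω : ℕ → Fin K × R =>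
        (Preorder.frestrictLe (π := fun _ : ℕ => Fin K × R) n ω, ω (n + 1))) hf (by fun_prop)
      rw [← h1, law_map_prod_succ, Measure.lintegral_compProd hf, lintegral_map _ (by fun_prop)]
      exact Measurable.lintegral_kernel_prod_right' hf
    have hW : Measurable fun h : (i : Finset.Iic n) → Fin K × R =>
        ∏ t : Fin (n + 1), w (h ⟨t, by simpa using Nat.lt_succ_iff.1 t.2⟩) := by
      fun_prop
    have eW : ∀ ω : ℕ → Fin K × R, ∏ t ∈ Finset.range (n + 1), w (ω t) =
        (fun h : (i : Finset.Iic n) → Fin K × R =>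
          ∏ t : Fin (n + 1), w (h ⟨t, by simpa using Nat.lt_succ_iff.1 t.2⟩))
          (Preorder.frestrictLe (π := fun _ : ℕ => Fin K × R) n ω) := by
      intro ω
      rw [Finset.prod_range]
      rfl
    have hgext : Measurable fun p => g (ext p) := hg.comp hext
    set W := fun h : (i : Finset.Iic n) → Fin K × R =>
        ∏ t : Fin (n + 1), w (h ⟨t, by simpa using Nat.lt_succ_iff.1 t.2⟩)
    simp only [Finset.prod_range_succ _ (n + 1), eext, eW]
    rw [key ν' hgext, key ν (f := fun p => g (ext p) * (W p.1 * w p.2)) (by fun_prop)]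
    -- Given the history, the weight `W h` of the past is constant, so only the last round has to be
    -- dominated; `ih` then applies to `g` averaged over that round under `ν'`.
    have hlast : ∀ h : (i : Finset.Iic n) → Fin K × R,
        ∫⁻ y, g (ext (h, y)) * (W h * w y) ∂(roundKernel π ν n h) ≤
          (∫⁻ y, g (ext (h, y)) ∂(roundKernel π ν' n h)) * W h := by
      intro h
      have hgh : Measurable fun y => g (ext (h, y)) := hgext.comp (by fun_prop)
      calc ∫⁻ y, g (ext (h, y)) * (W h * w y) ∂(roundKernel π ν n h)
          = ∫⁻ y, (g (ext (h, y)) * w y) * W h ∂(roundKernel π ν n h) := by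
            congr 1 with y
            ring
        _ = (∫⁻ y, g (ext (h, y)) * w y ∂(roundKernel π ν n h)) * W h :=
            lintegral_mul_const _ (by fun_prop)
        _ ≤ _ := by
            refine mul_le_mul' ?_ le_rfl
            rw [lintegral_roundKernel π ν n h (f := fun y => g (ext (h, y)) * w y) (by fun_prop),
              lintegral_roundKernel π ν' n h hgh]
            exact lintegral_mono fun a => hle a (fun x => g (ext (h, (a, x))))
              (hgh.comp (by fun_prop))
    refine (lintegral_mono fun ω => hlast _).trans ?_
    have := ih (g := fun h => ∫⁻ y, g (ext (h, y)) ∂(roundKernel π ν' n h))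
      (Measurable.lintegral_kernel_prod_right' hgext)
    simpa only [eW] using this

end Law

end RiskBandit

namespace RiskBandit

/-! ### Expected log-likelihood ratio and the two-model inequality -/

section Information

variable {K : ℕ} {R : Type*} [MeasurableSpace R]

lemma measurable_pulls (k : Fin K) (n : ℕ) : Measurable (pulls (R := R) k n) := by
  classical
  have : pulls (R := R) k n =
      fun ω => ∑ t ∈ Finset.range n, if (ω t).1 = k then 1 else 0 := by
    ext ω
    rw [pulls, Finset.card_filter]
  rw [this]
  refine Finset.measurable_sum _ fun t _ => ?_
  exact (measurable_of_finite fun a : Fin K => if a = k then 1 else 0).comp (by fun_prop)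

lemma pulls_le {K : ℕ} {R : Type*} (k : Fin K) (n : ℕ) (ω : ℕ → Fin K × R) : pulls k n ω ≤ n :=
  (Finset.card_filter_le _ _).trans (by simp)

lemma integrable_pulls (π : Policy K R) (ν : Fin K → ProbabilityMeasure R) (k : Fin K) (n : ℕ) :
    Integrable (fun ω => (pulls k n ω : ℝ)) (law π ν) := by
  refine Integrable.of_bound (C := n)
    ((measurable_from_top (f := fun m : ℕ => (m : ℝ))).comp
      (measurable_pulls k n)).aestronglyMeasurable (ae_of_all _ fun ω => ?_)
  simpa using pulls_le k n ω

lemma expectedPulls_eq_sum (π : Policy K R) (ν : Fin K → ProbabilityMeasure R) (k : Fin K)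
    (n : ℕ) :
    expectedPulls π ν k n =
      ∑ t ∈ Finset.range n, ((law π ν).map (fun ω => (ω t).1)).real {k} := by
  classical
  have : ∀ ω : ℕ → Fin K × R, (pulls k n ω : ℝ) =
      ∑ t ∈ Finset.range n, ((fun ω : ℕ → Fin K × R => (ω t).1) ⁻¹' {k}).indicator 1 ω := by
    intro ω
    rw [pulls, Finset.card_filter]
    push_cast
    exact Finset.sum_congr rfl fun t _ => by simp [Set.indicator_apply]
  have hm : ∀ t, MeasurableSet ((fun ω : ℕ → Fin K × R => (ω t).1) ⁻¹' {k}) := fun t =>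
    (measurableSet_singleton k).preimage (by fun_prop)
  unfold expectedPulls
  simp_rw [this]
  rw [integral_finsetSum _ fun t _ => by exact (integrable_const (1 : ℝ)).indicator (hm t)]
  refine Finset.sum_congr rfl fun t _ => ?_
  rw [integral_indicator_one (hm t), map_measureReal_apply (by fun_prop) (measurableSet_singleton k)]

/-- A function of one arm's reward, counted only in the rounds in which this arm is pulled. -/
lemma integral_ite_arm (π : Policy K R) (ν : Fin K → ProbabilityMeasure R) (k : Fin K)
    {l : R → ℝ} (hl : Measurable l) (hint : Integrable l (ν k : Measure R)) (t : ℕ) :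
    Integrable (fun ω => if (ω t).1 = k then l (ω t).2 else 0) (law π ν) ∧
      ∫ ω, (if (ω t).1 = k then l (ω t).2 else 0) ∂(law π ν) =
        ((law π ν).map (fun ω => (ω t).1)).real {k} * ∫ x, l x ∂(ν k : Measure R) := by
  let F : Fin K × R → ℝ := fun y => if y.1 = k then l y.2 else 0
  have hF : Measurable F :=
    Measurable.ite ((measurableSet_singleton k).preimage measurable_fst) (by fun_prop) (by fun_prop)
  have hm : IsProbabilityMeasure ((law π ν).map (fun ω => (ω t).1)) :=
    Measure.isProbabilityMeasure_map (by exact Measurable.aemeasurable (by fun_prop))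
  have hI : Integrable F ((law π ν).map (fun ω => (ω t).1) ⊗ₘ rewardKernel ν) := by
    rw [Measure.integrable_compProd_iff hF.aestronglyMeasurable]
    refine ⟨ae_of_all _ fun a => ?_, Integrable.of_finite⟩
    by_cases h : a = k
    · subst h
      simpa [F] using hint
    · simp [F, h]
  have hI' : Integrable F ((law π ν).map (fun ω => ω t)) := by rwa [law_map_eval]
  refine ⟨(integrable_map_measure hF.aestronglyMeasurable
    (measurable_pi_apply t).aemeasurable).1 hI', ?_⟩
  have h1 := integral_map (μ := law π ν) (φ := fun ω => ω t) (f := F)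
    (measurable_pi_apply t).aemeasurable
    hF.aestronglyMeasurable
  refine h1.symm.trans ?_
  rw [law_map_eval, Measure.integral_compProd hI]
  have h2 : ∀ a, ∫ x, F (a, x) ∂(rewardKernel ν a) =
      ({k} : Set (Fin K)).indicator (fun _ => ∫ x, l x ∂(ν k : Measure R)) a := by
    intro a
    by_cases h : a = k
    · subst h
      simp [F]
    · simp [F, h]
  simp_rw [h2]
  rw [integral_indicator_const _ (measurableSet_singleton k), smul_eq_mul]

/-- Bretagnolle-Huber type inequality for two bandit models that differ in one arm only. -/
lemma exp_neg_le_law_add_law_compl (π : Policy K R) (ν ν' : Fin K → ProbabilityMeasure R)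
    (k : Fin K) (hne : ∀ j, j ≠ k → ν' j = ν j)
    (hkl : klDiv (ν k : Measure R) (ν' k : Measure R) ≠ ∞) (n : ℕ)
    {B : Set ((i : Finset.Iic n) → Fin K × R)} (hB : MeasurableSet B) :
    Real.exp (-(expectedPulls π ν k (n + 1) *
        (klDiv (ν k : Measure R) (ν' k : Measure R)).toReal + 1)) ≤
      (law π ν).real (Preorder.frestrictLe (π := fun _ : ℕ => Fin K × R) n ⁻¹' B) +
        (law π ν').real (Preorder.frestrictLe (π := fun _ : ℕ => Fin K × R) n ⁻¹' Bᶜ) := by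
  obtain ⟨hac, hint⟩ := klDiv_ne_top_iff.1 hkl
  rw [toReal_klDiv_of_measure_eq hac (by simp)]
  set l := llr (ν k : Measure R) (ν' k : Measure R) with hl_def
  have hl : Measurable l := measurable_llr _ _
  let F : Fin K × R → ℝ := fun y => if y.1 = k then l y.2 else 0
  have hF : Measurable F :=
    Measurable.ite ((measurableSet_singleton k).preimage measurable_fst) (by fun_prop) (by fun_prop)
  let S : (ℕ → Fin K × R) → ℝ := fun ω => ∑ t ∈ Finset.range (n + 1), F (ω t)
  have hS : Measurable S := by fun_prop
  have hSint : Integrable S (law π ν) :=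
    integrable_finsetSum _ fun t _ => (integral_ite_arm π ν k hl hint t).1
  have hSval : ∫ ω, S ω ∂(law π ν) =
      expectedPulls π ν k (n + 1) * ∫ x, l x ∂(ν k : Measure R) := by
    rw [expectedPulls_eq_sum, Finset.sum_mul]
    simp only [S]
    rw [integral_finsetSum _ fun t _ => (integral_ite_arm π ν k hl hint t).1]
    exact Finset.sum_congr rfl fun t _ => (integral_ite_arm π ν k hl hint t).2
  -- On arm `k` this is a.e. the density of `ν' k` with respect to `ν k`; on the other arms it is
  -- `1`.
  let w : Fin K × R → ℝ≥0∞ := fun y => ENNReal.ofReal (Real.exp (-F y))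
  have hw : Measurable w := by fun_prop
  have hle : ∀ a, ∀ f : R → ℝ≥0∞, Measurable f →
      ∫⁻ x, f x * w (a, x) ∂(ν a : Measure R) ≤ ∫⁻ x, f x ∂(ν' a : Measure R) := by
    intro a f hf
    by_cases h : a = k
    · subst h
      have h1 : ∀ᵐ x ∂(ν a : Measure R),
          f x * w (a, x) = (ν' a : Measure R).rnDeriv (ν a : Measure R) x * f x := by
        filter_upwards [exp_neg_llr hac, Measure.rnDeriv_ne_top (ν' a : Measure R)
          (ν a : Measure R)] with x hx hx'
        have : w (a, x) = (ν' a : Measure R).rnDeriv (ν a : Measure R) x := by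
          simp only [w, F, if_true]
          rw [hl_def, hx, ENNReal.ofReal_toReal hx']
        rw [this, mul_comm]
      rw [lintegral_congr_ae h1,
        ← Pi.mul_def (f := (ν' a : Measure R).rnDeriv (ν a : Measure R)),
        ← lintegral_withDensity_eq_lintegral_mul _ (Measure.measurable_rnDeriv _ _) hf]
      -- Only an inequality: `ν' k` may have a part singular to `ν k`.
      exact lintegral_mono' (Measure.withDensity_rnDeriv_le _ _) le_rfl
    · simp [w, F, h, hne a h]
  have eW : ∀ ω : ℕ → Fin K × R,
      ∏ t ∈ Finset.range (n + 1), w (ω t) = ENNReal.ofReal (Real.exp (-S ω)) := by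
    intro ω
    simp only [w, S]
    rw [← ENNReal.ofReal_prod_of_nonneg fun _ _ => (Real.exp_pos _).le, ← Real.exp_sum,
      Finset.sum_neg_distrib]
  have hchange := fun g hg => lintegral_law_mul_prod_le π ν ν' hw hle n (g := g) hg
  simp only [eW] at hchange
  have hexp_le : ∫⁻ ω, ENNReal.ofReal (Real.exp (-S ω)) ∂(law π ν) ≤ 1 := by
    simpa using hchange (fun _ => 1) measurable_const
  have hexp_int : Integrable (fun ω => Real.exp (-S ω)) (law π ν) := by
    refine (lintegral_ofReal_ne_top_iff_integrable (by fun_prop)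
      (ae_of_all _ fun _ => (Real.exp_pos _).le)).1 (hexp_le.trans_lt ENNReal.one_lt_top).ne
  have hexp_val : ∫ ω, Real.exp (-S ω) ∂(law π ν) ≤ 1 := by
    rw [integral_eq_lintegral_of_nonneg_ae (ae_of_all _ fun _ => (Real.exp_pos _).le)
      (by fun_prop)]
    exact ENNReal.toReal_le_of_le_ofReal zero_le_one (by simpa using hexp_le)
  -- The `1` in the exponent comes from `max S 0 ≤ S + exp (-S)` and `E[exp (-S)] ≤ 1`. The positive
  -- part is needed because `exp (-max S 0) = min 1 (exp (-S))`.
  have hpos_le : ∫ ω, max (S ω) 0 ∂(law π ν) ≤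
      expectedPulls π ν k (n + 1) * ∫ x, l x ∂(ν k : Measure R) + 1 := by
    calc ∫ ω, max (S ω) 0 ∂(law π ν) ≤ ∫ ω, (S ω + Real.exp (-S ω)) ∂(law π ν) := by
          refine integral_mono hSint.pos_part (hSint.add hexp_int) fun ω => ?_
          have h1 := Real.add_one_le_exp (-S ω)
          have h2 := Real.exp_pos (-S ω)
          exact max_le (by dsimp; linarith) (by dsimp; linarith)
      _ ≤ _ := by
          rw [integral_add hSint hexp_int, hSval]
          gcongr
  have hbdd : Integrable (fun ω => Real.exp (-max (S ω) 0)) (law π ν) := by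
    refine Integrable.of_bound (C := 1) (by fun_prop) (ae_of_all _ fun ω => ?_)
    rw [Real.norm_eq_abs, abs_of_pos (Real.exp_pos _)]
    exact Real.exp_le_one_iff.2 (by simp)
  have hjensen : Real.exp (∫ ω, -max (S ω) 0 ∂(law π ν)) ≤
      ∫ ω, Real.exp (-max (S ω) 0) ∂(law π ν) :=
    convexOn_exp.map_integral_le Real.continuous_exp.continuousOn isClosed_univ
      (ae_of_all _ fun _ => Set.mem_univ _) hSint.pos_part.neg hbdd
  have hfr : Measurable (Preorder.frestrictLe (π := fun _ : ℕ => Fin K × R) n) := by fun_prop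
  have hmain : ∫⁻ ω, ENNReal.ofReal (Real.exp (-max (S ω) 0)) ∂(law π ν) ≤
      law π ν (Preorder.frestrictLe (π := fun _ : ℕ => Fin K × R) n ⁻¹' B) +
        law π ν' (Preorder.frestrictLe (π := fun _ : ℕ => Fin K × R) n ⁻¹' Bᶜ) := by
    have h1 := hchange (Bᶜ.indicator 1) (measurable_one.indicator hB.compl)
    have h2 : ∫⁻ ω, Bᶜ.indicator 1 (Preorder.frestrictLe (π := fun _ : ℕ => Fin K × R) n ω)
        ∂(law π ν') = law π ν' (Preorder.frestrictLe (π := fun _ : ℕ => Fin K × R) n ⁻¹' Bᶜ) := by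
      rw [← lintegral_indicator_one (hfr hB.compl)]
      rfl
    have h3 : ∫⁻ ω, B.indicator 1 (Preorder.frestrictLe (π := fun _ : ℕ => Fin K × R) n ω)
        ∂(law π ν) = law π ν (Preorder.frestrictLe (π := fun _ : ℕ => Fin K × R) n ⁻¹' B) := by
      rw [← lintegral_indicator_one (hfr hB)]
      rfl
    rw [← h3, ← h2]
    refine le_trans ?_ (add_le_add_right h1 _)
    rw [← lintegral_add_left (by exact (measurable_one.indicator hB).comp hfr)]
    refine lintegral_mono fun ω => ?_
    -- The minimum is bounded by `1` on `B` and by the likelihood ratio `exp (-S)` off `B`.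
    by_cases h : Preorder.frestrictLe (π := fun _ : ℕ => Fin K × R) n ω ∈ B
    · simp [h]
    · simp only [h, Set.indicator, if_false, Set.mem_compl_iff, not_false_eq_true, if_true,
        Pi.one_apply, one_mul, zero_add]
      gcongr
      exact le_max_left _ _
  calc _ ≤ Real.exp (∫ ω, -max (S ω) 0 ∂(law π ν)) := by
        rw [integral_neg]
        gcongr
    _ ≤ _ := hjensen
    _ ≤ _ := by
        rw [integral_eq_lintegral_of_nonneg_ae (ae_of_all _ fun _ => (Real.exp_pos _).le)
          (by fun_prop), measureReal_def, measureReal_def, ← ENNReal.toReal_add (by finiteness)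
          (by finiteness)]
        exact ENNReal.toReal_mono (by finiteness) hmain

end Information

end RiskBandit

namespace RiskBandit

/-! ### Regret controls the numbers of pulls -/

section Regret

variable {K : ℕ} {R : Type*} [MeasurableSpace R]

lemma sum_le_regret (ρ : ProbabilityMeasure R → ℝ) (π : Policy K R)
    (ν : Fin K → ProbabilityMeasure R) {b : Fin K → ℝ}
    (hb : ∀ a, b a ≤ (⨆ j, ρ (ν j)) - ρ (ν a)) (n : ℕ) :
    ∫ ω, ∑ t ∈ Finset.range n, b (ω t).1 ∂(law π ν) ≤ regret ρ π ν n := by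
  have hint : ∀ f : Fin K → ℝ,
      Integrable (fun ω => ∑ t ∈ Finset.range n, f (ω t).1) (law π ν) := by
    intro f
    refine integrable_finsetSum _ fun t _ => ?_
    have hm : Measurable fun ω : ℕ → Fin K × R => (ω t).1 := by fun_prop
    have := Measure.isProbabilityMeasure_map (μ := law π ν) hm.aemeasurable
    exact Integrable.comp_measurable (g := f) Integrable.of_finite hm
  exact integral_mono (hint b) (hint fun a => (⨆ j, ρ (ν j)) - ρ (ν a))
    fun ω => Finset.sum_le_sum fun t _ => hb _

lemma natCast_pulls {K : ℕ} {R : Type*} (k : Fin K) (n : ℕ) (ω : ℕ → Fin K × R) :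
    (pulls k n ω : ℝ) = ∑ t ∈ Finset.range n, if (ω t).1 = k then (1 : ℝ) else 0 := by
  rw [pulls, Finset.card_filter]
  push_cast
  rfl

lemma mul_expectedPulls_le_regret (ρ : ProbabilityMeasure R → ℝ) (π : Policy K R)
    (ν : Fin K → ProbabilityMeasure R) (k : Fin K) (n : ℕ) :
    ((⨆ j, ρ (ν j)) - ρ (ν k)) * expectedPulls π ν k n ≤ regret ρ π ν n := by
  set Δ := (⨆ j, ρ (ν j)) - ρ (ν k)
  refine le_trans (le_of_eq ?_) (sum_le_regret ρ π ν (b := fun a => if a = k then Δ else 0)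
    (fun a => ?_) n)
  · rw [expectedPulls, ← integral_const_mul]
    simp_rw [natCast_pulls, Finset.mul_sum, mul_ite, mul_one, mul_zero]
  · split_ifs with h
    · subst h
      exact le_rfl
    · exact sub_nonneg.2 (le_ciSup (f := fun j => ρ (ν j)) (Set.finite_range _).bddAbove a)

/-- Each round spent off arm `k` costs at least `δ`. This is applied to the alternative model, where
`k` is the best arm. -/
lemma mul_sub_expectedPulls_le_regret (ρ : ProbabilityMeasure R → ℝ) (π : Policy K R)
    (ν : Fin K → ProbabilityMeasure R) (k : Fin K) {δ : ℝ}
    (hδ : ∀ j, j ≠ k → ρ (ν j) + δ ≤ ρ (ν k)) (n : ℕ) :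
    δ * (n - expectedPulls π ν k n) ≤ regret ρ π ν n := by
  have hsup := le_ciSup (f := fun j => ρ (ν j)) (Set.finite_range _).bddAbove
  refine le_trans (le_of_eq ?_) (sum_le_regret ρ π ν
    (b := fun a => δ * (1 - if a = k then 1 else 0)) (fun a => ?_) n)
  · have : ∀ ω : ℕ → Fin K × R,
        ∑ t ∈ Finset.range n, δ * (1 - if (ω t).1 = k then (1 : ℝ) else 0) =
          δ * (n - pulls k n ω) := by
      intro ω
      rw [← Finset.mul_sum, Finset.sum_sub_distrib, natCast_pulls]
      simp
    simp_rw [this]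
    rw [integral_const_mul, integral_sub (integrable_const _) (integrable_pulls π ν k n)]
    simp [expectedPulls]
  · split_ifs with h
    · simpa using hsup a
    · have h1 := hsup k
      have h2 := hδ a h
      linarith

end Regret

/-! ### The asymptotic lower bound -/

section LowerBound

variable {K : ℕ} {R : Type*} [MeasurableSpace R]

lemma expectedPulls_nonneg (π : Policy K R) (ν : Fin K → ProbabilityMeasure R) (k : Fin K)
    (n : ℕ) : 0 ≤ expectedPulls π ν k n :=
  integral_nonneg fun _ => Nat.cast_nonneg _

/-- Markov's inequality at level `n / 2`, for `T_k(n)` under `ν` and for `n - T_k(n)` under `ν'`,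
bounds both error probabilities. -/
lemma exp_neg_le_expectedPulls (π : Policy K R) (ν ν' : Fin K → ProbabilityMeasure R)
    (k : Fin K) (hne : ∀ j, j ≠ k → ν' j = ν j)
    (hkl : klDiv (ν k : Measure R) (ν' k : Measure R) ≠ ∞) {n : ℕ} (hn : n ≠ 0) :
    Real.exp (-(expectedPulls π ν k n *
        (klDiv (ν k : Measure R) (ν' k : Measure R)).toReal + 1)) * n ≤
      2 * expectedPulls π ν k n + 2 * (n - expectedPulls π ν' k n) := by
  obtain ⟨m, rfl⟩ := Nat.exists_eq_succ_of_ne_zero hn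
  -- Extends a history by repeating its last pair; `pulls k (m + 1)` reads only times `0, …, m`.
  let e : ((i : Finset.Iic m) → Fin K × R) → (ℕ → Fin K × R) :=
    fun h t => h ⟨min t m, by simp⟩
  have he : Measurable e := by fun_prop
  have hpe : ∀ ω : ℕ → Fin K × R,
      pulls k (m + 1) (e (Preorder.frestrictLe (π := fun _ : ℕ => Fin K × R) m ω)) =
        pulls k (m + 1) ω := by
    intro ω
    unfold pulls
    congr 1
    refine Finset.filter_congr fun t ht => ?_
    have : min t m = t := min_eq_left (Nat.lt_succ_iff.1 (Finset.mem_range.1 ht))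
    simp [e, this]
  have hp : Measurable fun ω : ℕ → Fin K × R => (pulls k (m + 1) ω : ℝ) :=
    (measurable_from_top (f := fun m : ℕ => (m : ℝ))).comp (measurable_pulls k (m + 1))
  set N : ℝ := ((m + 1 : ℕ) : ℝ) with hN
  have hNpos : 0 < N := by positivity
  let B : Set ((i : Finset.Iic m) → Fin K × R) := {h | N / 2 ≤ (pulls k (m + 1) (e h) : ℝ)}
  have hB : MeasurableSet B := measurableSet_le measurable_const (hp.comp he)
  have hmain := exp_neg_le_law_add_law_compl π ν ν' k hne hkl m hB
  have e1 : Preorder.frestrictLe (π := fun _ : ℕ => Fin K × R) m ⁻¹' B =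
      {ω | N / 2 ≤ (pulls k (m + 1) ω : ℝ)} := by
    ext ω
    simp only [B, Set.mem_preimage, Set.mem_ofPred_eq, hpe]
  have e2 : Preorder.frestrictLe (π := fun _ : ℕ => Fin K × R) m ⁻¹' Bᶜ ⊆
      {ω | N / 2 ≤ N - (pulls k (m + 1) ω : ℝ)} := by
    intro ω h
    simp only [B, Set.mem_preimage, Set.mem_compl_iff, Set.mem_ofPred_eq, hpe, not_le] at h ⊢
    linarith
  have m1 := mul_meas_ge_le_integral_of_nonneg (μ := law π ν)
    (ae_of_all _ fun ω => Nat.cast_nonneg (pulls k (m + 1) ω)) (integrable_pulls π ν k (m + 1))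
    (N / 2)
  have m2 := mul_meas_ge_le_integral_of_nonneg (μ := law π ν')
    (f := fun ω => N - (pulls k (m + 1) ω : ℝ))
    (ae_of_all _ fun ω => sub_nonneg.2 (Nat.cast_le.2 (pulls_le k (m + 1) ω)))
    ((integrable_const N).sub (integrable_pulls π ν' k (m + 1))) (N / 2)
  rw [integral_sub (integrable_const N) (integrable_pulls π ν' k (m + 1))] at m2
  simp only [integral_const, probReal_univ, one_smul] at m2
  rw [e1] at hmain
  have h3 := measureReal_mono (μ := law π ν') e2
  change N / 2 * _ ≤ expectedPulls π ν k (m + 1) at m1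
  change N / 2 * _ ≤ N - expectedPulls π ν' k (m + 1) at m2
  have h4 := mul_le_mul_of_nonneg_right (hmain.trans (add_le_add_right h3 _)) hNpos.le
  refine h4.trans ?_
  linarith

/-- The asymptotic lower bound against a single alternative law of arm `k`. -/
lemma inv_klDiv_le_liminf (ρ : ProbabilityMeasure R → ℝ) (𝒬 : Fin K → Set (ProbabilityMeasure R))
    (π : Policy K R) (hπ : Consistent ρ 𝒬 π)
    (ν : Fin K → ProbabilityMeasure R) (hν : ∀ j, ν j ∈ 𝒬 j)
    (kStar : Fin K) (hStar : ∀ j, ρ (ν j) ≤ ρ (ν kStar))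
    (k : Fin K) (hk : ρ (ν k) < ρ (ν kStar))
    (η : ProbabilityMeasure R) (hη : η ∈ 𝒬 k) (hρ : ρ (ν kStar) < ρ η) :
    (((klDiv (ν k : Measure R) (η : Measure R))⁻¹ : ℝ≥0∞) : EReal) ≤
      liminf (fun n : ℕ => ((expectedPulls π ν k n / Real.log n : ℝ) : EReal)) atTop := by
  by_cases hkl : klDiv (ν k : Measure R) (η : Measure R) = ∞
  · rw [hkl, ENNReal.inv_top, EReal.coe_ennreal_zero]
    refine le_liminf_of_le (by isBoundedDefault) (Eventually.of_forall fun n => ?_)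
    exact EReal.coe_nonneg.2 (div_nonneg (expectedPulls_nonneg π ν k n) (Real.log_natCast_nonneg n))
  -- Zero divergence would force `ν k = η`, but their risks lie on opposite sides of the optimum.
  have hkl0 : klDiv (ν k : Measure R) (η : Measure R) ≠ 0 := by
    intro h
    have : ν k = η := Subtype.ext
      ((klDiv_eq_zero_iff (μ := (ν k : Measure R)) (ν := (η : Measure R))).1 h)
    exact absurd (this ▸ hρ) (not_lt.2 hk.le)
  set d := (klDiv (ν k : Measure R) (η : Measure R)).toReal with hd_def
  have hd : 0 < d := ENNReal.toReal_pos hkl0 hkl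
  have hdinv : (((klDiv (ν k : Measure R) (η : Measure R))⁻¹ : ℝ≥0∞) : EReal) =
      ((d⁻¹ : ℝ) : EReal) := by
    rw [hd_def, ← ENNReal.toReal_inv, EReal.coe_ennreal_toReal (ENNReal.inv_ne_top.2 hkl0)]
  rw [hdinv, ← EReal.ge_of_forall_gt_iff_ge]
  intro c hc
  have hcd : c * d < 1 := by
    rw [EReal.coe_lt_coe_iff] at hc
    calc c * d < d⁻¹ * d := by gcongr
      _ = 1 := inv_mul_cancel₀ hd.ne'
  classical
  let ν' := Function.update ν k η
  have hν'k : ν' k = η := Function.update_self ..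
  have hne : ∀ j, j ≠ k → ν' j = ν j := fun j hj => Function.update_of_ne hj ..
  have hν' : ∀ j, ν' j ∈ 𝒬 j := by
    intro j
    by_cases h : j = k
    · subst h
      rwa [hν'k]
    · rw [hne j h]
      exact hν j
  -- One `a` of the slack is spent on the regret bound `n ^ a`, the other on the additive `1`,
  -- absorbed once `log n ≥ 1 / a`.
  obtain ⟨a, ha, hca⟩ : ∃ a : ℝ, 0 < a ∧ c * d = 1 - 2 * a := ⟨(1 - c * d) / 2, by linarith, by ring⟩
  set δ := ρ η - ρ (ν kStar)
  have hδ : 0 < δ := sub_pos.2 hρ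
  have hgap' : ∀ j, j ≠ k → ρ (ν' j) + δ ≤ ρ (ν' k) := by
    intro j hj
    rw [hne j hj, hν'k]
    have := hStar j
    simp only [δ]
    linarith
  set Δ := (⨆ j, ρ (ν j)) - ρ (ν k)
  have hΔ : 0 < Δ := sub_pos.2 (hk.trans_le
    (le_ciSup (f := fun j => ρ (ν j)) (Set.finite_range _).bddAbove kStar))
  have ev1 : ∀ᶠ n : ℕ in atTop, regret ρ π ν n / (n : ℝ) ^ a < Δ / 4 :=
    (hπ ν hν a ha).eventually_lt_const (by positivity)
  have ev2 : ∀ᶠ n : ℕ in atTop, regret ρ π ν' n / (n : ℝ) ^ a < δ / 4 :=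
    (hπ ν' hν' a ha).eventually_lt_const (by positivity)
  have ev3 : ∀ᶠ n : ℕ in atTop, 1 / a ≤ Real.log n :=
    (Real.tendsto_log_atTop.comp tendsto_natCast_atTop_atTop).eventually_ge_atTop _
  refine le_liminf_of_le (by isBoundedDefault) ?_
  filter_upwards [ev1, ev2, ev3, eventually_gt_atTop 0] with n h1 h2 h3 hn
  have hn' : (0 : ℝ) < n := Nat.cast_pos.2 hn
  have hpow : 0 < (n : ℝ) ^ a := Real.rpow_pos_of_pos hn' a
  have hlog : 0 < Real.log n := lt_of_lt_of_le (by positivity) h3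
  rw [div_lt_iff₀ hpow] at h1 h2
  have b1 : expectedPulls π ν k n ≤ (n : ℝ) ^ a / 4 := by
    have := (mul_expectedPulls_le_regret ρ π ν k n).trans h1.le
    refine le_of_mul_le_mul_left (this.trans_eq ?_) hΔ
    ring
  have b2 : n - expectedPulls π ν' k n ≤ (n : ℝ) ^ a / 4 := by
    have := (mul_sub_expectedPulls_le_regret ρ π ν' k hgap' n).trans h2.le
    refine le_of_mul_le_mul_left (this.trans_eq ?_) hδ
    ring
  have b3 := exp_neg_le_expectedPulls π ν ν' k hne (by rwa [hν'k]) hn.ne'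
  rw [hν'k, ← hd_def] at b3
  have b4 : -(expectedPulls π ν k n * d + 1) + Real.log n ≤ a * Real.log n := by
    rw [← Real.exp_le_exp, Real.exp_add, Real.exp_log hn', mul_comm a, ← Real.rpow_def_of_pos hn']
    linarith
  rw [div_le_iff₀ ha] at h3
  rw [EReal.coe_le_coe_iff, le_div_iff₀ hlog]
  refine le_of_mul_le_mul_right ?_ hd
  calc c * Real.log n * d = (1 - 2 * a) * Real.log n := by rw [← hca]; ring
    _ ≤ expectedPulls π ν k n * d := by linarith

lemma inv_Kinf_le_liminf (ρ : ProbabilityMeasure R → ℝ) (𝒬 : Fin K → Set (ProbabilityMeasure R))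
    (π : Policy K R) (hπ : Consistent ρ 𝒬 π)
    (ν : Fin K → ProbabilityMeasure R) (hν : ∀ j, ν j ∈ 𝒬 j)
    (kStar : Fin K) (hStar : ∀ j, ρ (ν j) ≤ ρ (ν kStar))
    (k : Fin K) (hk : ρ (ν k) < ρ (ν kStar)) :
    (((Kinf ρ (𝒬 k) (ν k) (ρ (ν kStar)))⁻¹ : ℝ≥0∞) : EReal) ≤
      liminf (fun n : ℕ => ((expectedPulls π ν k n / Real.log n : ℝ) : EReal)) atTop := by
  set L := liminf (fun n : ℕ => ((expectedPulls π ν k n / Real.log n : ℝ) : EReal)) atTop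
    with hL_def
  have hL : 0 ≤ L := by
    refine le_liminf_of_le (by isBoundedDefault) (Eventually.of_forall fun n => ?_)
    exact EReal.coe_nonneg.2 (div_nonneg (expectedPulls_nonneg π ν k n) (Real.log_natCast_nonneg n))
  -- In `ℝ≥0∞` the inverse of an infimum is the supremum of the inverses, which also covers the
  -- values `0` and `∞`.
  rw [← EReal.coe_toENNReal hL, EReal.coe_ennreal_le_coe_ennreal_iff]
  simp only [Kinf, ENNReal.inv_iInf]
  refine iSup₂_le fun η hη => ?_
  rw [← EReal.coe_ennreal_le_coe_ennreal_iff, EReal.coe_toENNReal hL]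
  exact inv_klDiv_le_liminf ρ 𝒬 π hπ ν hν kStar hStar k hk η hη.1 hη.2

/-- If `KinfGe` is right-continuous at `r`, then it dominates `Kinf` at `r`. -/
lemma Kinf_le_KinfGe_of_continuousWithinAt (ρ : ProbabilityMeasure R → ℝ)
    (𝒬 : Set (ProbabilityMeasure R)) (μ : ProbabilityMeasure R) (r : ℝ)
    (hc : ContinuousWithinAt (KinfGe ρ 𝒬 μ) (Set.Ici r) r) :
    Kinf ρ 𝒬 μ r ≤ KinfGe ρ 𝒬 μ r := by
  refine ge_of_tendsto (hc.mono_left (nhdsWithin_mono r Set.Ioi_subset_Ici_self)) ?_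
  -- For `s > r`, the constraint `ρ η ≥ s` implies `ρ η > r`; then `s` decreases to `r`.
  filter_upwards [self_mem_nhdsWithin] with s hs
  exact biInf_mono fun η hη => ⟨hη.1, lt_of_lt_of_le hs hη.2⟩

end LowerBound

end RiskBandit

theorem mainTheorem2 (C : Set ℝ) (hC : IsCompact C) (ρ : ProbabilityMeasure C → ℝ)
    (K : ℕ) (𝒬 : Fin K → Set (ProbabilityMeasure C))
    (π : RiskBandit.Policy K C) (hπ : RiskBandit.Consistent ρ 𝒬 π)
    (ν : Fin K → ProbabilityMeasure C) (hν : ∀ j, ν j ∈ 𝒬 j)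
    (kStar : Fin K) (hStar : ∀ j, ρ (ν j) ≤ ρ (ν kStar))
    (k : Fin K) (hk : ρ (ν k) < ρ (ν kStar)) :
    (((RiskBandit.Kinf ρ (𝒬 k) (ν k) (ρ (ν kStar)))⁻¹ : ℝ≥0∞) : EReal) ≤
        liminf (fun n : ℕ =>
          ((RiskBandit.expectedPulls π ν k n / Real.log n : ℝ) : EReal)) atTop ∧
    (ContinuousWithinAt (RiskBandit.KinfGe ρ (𝒬 k) (ν k))
        (Set.Ici (ρ (ν kStar))) (ρ (ν kStar)) →
      (((RiskBandit.KinfGe ρ (𝒬 k) (ν k) (ρ (ν kStar)))⁻¹ : ℝ≥0∞) : EReal) ≤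
        liminf (fun n : ℕ =>
          ((RiskBandit.expectedPulls π ν k n / Real.log n : ℝ) : EReal)) atTop) := by
  have h := RiskBandit.inv_Kinf_le_liminf ρ 𝒬 π hπ ν hν kStar hStar k hk
  refine ⟨h, fun hc => le_trans ?_ h⟩
  rw [EReal.coe_ennreal_le_coe_ennreal_iff, ENNReal.inv_le_inv]
  exact RiskBandit.Kinf_le_KinfGe_of_continuousWithinAt ρ (𝒬 k) (ν k) _ hc
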